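/- Let $d\ge 2$ and $[d]=\{1,\dots,d\}$. **Posets.** An ordered set partition of $[d]$ is a list $\mathcal S=(S_1,\dots,S_k)$ of nonempty pairwise disjoint sets with union $[d]$; $\mathrm{Type}(\mathcal S)=\{|S_1|+\dots+|S_m| : 1\le m\le k-1\}\subseteq[d-1]$. Let $\mathcal O_d$ be the set of these, ordered by refinement: $\mathcal S\le\mathcal S'$ iff $\mathcal S'$ arises from $\mathcal S$ by merging consecutive blocks. $\mathcal S$ is standard if every element of $S_i$ is smaller than every element of $S_{i+1}$ for all $i<k$. A decorated ordered set partition is a pair $(\mathcal S,B)$ with $B=[d-1]$ if $k=1$ and $\emptyset\ne B\subseteq\mathrm{Type}(\mathcal S)$ if $k>1$. Let $\mathcal F_d$ be the set of these, ordered by $(\mathcal S,B)\preceq(\mathcal S',B')$ iff $\mathcal S\le\mathcal S'$ and $B\subseteq B'$. Let $\mathcal Z_d$ be the subposet of the dual of $\mathcal F_d$ induced on the $(\mathcal S,B)$ with $\mathcal S$ standard. **Cones.** Let $W=\mathbb R^d/\mathbb R\mathbf 1$, and put $\delta_i(w)=w_{i+1}-w_i$ for $w\in W$, $1\le i\le d-1$.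 Let $$\sigma_{\mathcal S}=\{w\in W: w_i=w_j \text{ if } i,j\in S_a \text{ for some } a;\ w_i\le w_j\text{ if } i\in S_a,\ j\in S_b,\ a<b\},$$ $$\nu_B=\{w\in W:\delta_i(w)=\delta_j(w)\text{ if } i,j\in B;\ \delta_i(w)\le\delta_j(w)\text{ if } i\notin B,\ j\in B\}.$$ Let $\Phi=\{w\in W:w_1\le\dots\le w_d\}$ and let $\Sigma(\Phi)$ be the set of its nonempty faces. For a polytope $P$ in a translate $U=x_0+\mathbf 1^\perp$ of $\mathbf 1^\perp\subset\mathbb R^d$, where $x_0\in\mathbb R\mathbf 1$, let $\langle w,u\rangle=w\cdot(u-x_0)$ for $w\in W$, $u\in U$, and let the normal fan $\Sigma(P)$ be the set of the normal cones $\{w\in W:\langle w,y\rangle\ge\langle w,y'\rangle\ \forall y\in F,\ y'\in P\}$, with $F$ ranging over the nonempty faces of $P$. Let $$\Omega(P)=\{(\sigma,\phi)\in\Sigma(P)\times\Sigma(\Phi):\sigma^\circ\cap\phi^\circ\neq\emptyset\},\qquad (\sigma,\phi)\le(\sigma',\phi')\iff\sigma\subseteq\sigma'\text{ and }\phi\subseteq\phi',$$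 where $^\circ$ denotes the relative interior. **The polytope.** Let $a_i=-e_i+e_{i+1}\in\mathbb R^d$ for $1\le i\le d-1$, $T_\gamma(x)=\gamma+\sum_{i=1}^{d-1}x_ia_i$ for $\gamma\in\mathbb R^d$ and $x\in\mathbb R^{d-1}$, $\Delta_{d-2}=\mathrm{Conv}\{e_1,\dots,e_{d-1}\}\subset\mathbb R^{d-1}$, $\gamma_0=(1^2,2^2,\dots,d^2)$ and $P=T_{\gamma_0}(\Delta_{d-2})$. **Theorem.** 1. The map $(\mathcal S,B)\mapsto(\nu_B,\sigma_{\mathcal S})$ is a poset isomorphism from $\mathcal Z_d$ to $\Omega(P)$. 2. Let $\lambda(\mathcal S,B)=\sigma_{\mathcal S}$, and let $\mathcal Z_d^\lambda$ be the set $\{((\mathcal S,B),\sigma_{\mathcal S}):(\mathcal S,B)\in\mathcal Z_d\}$ with the order of $\mathcal Z_d$ on first entries. Then $\lambda$ maps $\mathcal Z_d$ into $\Sigma(\Phi)$, and $((\mathcal S,B),\sigma_{\mathcal S})\mapsto(\nu_B,\sigma_{\mathcal S})$ is an isomorphism of $\Sigma(\Phi)$-posets from $\mathcal Z_d^\lambda$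 to $\Omega(P)$, that is, a poset isomorphism that preserves second entries. 3. The $\mathfrak S_d$-symmetrization $\mathfrak S_d(P)=\mathrm{Conv}\{(x_{\pi(1)},\dots,x_{\pi(d)}) : \pi\in\mathfrak S_d,\ x\in P\}$ equals $\mathrm{Conv}\{\pi(\gamma_0)+\pi(a_i) : \pi\in\mathfrak S_d,\ i\in[d-1]\}$, where $\pi(x)=(x_{\pi^{-1}(1)},\dots,x_{\pi^{-1}(d)})$, and the poset of its nonempty faces, ordered by inclusion, is isomorphic to $\mathcal F_d$. -/

import Mathlib

/-! Throughout `d = n + 1`. The set `[d]` is modelled by `Fin (n + 1)` and `[d - 1]` by `Fin n`;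
the element `i` of `Fin (n + 1)` or of `Fin n` stands for the number `i + 1`. -/

namespace HybridPoset

/-! ### Ordered set partitions -/

/-- For a list of blocks, `x` lies in a block that comes weakly before a block containing `y`. -/
def WeaklyBefore {α : Type*} (L : List (Finset α)) (x y : α) : Prop :=
  ∃ i j : Fin L.length, i ≤ j ∧ x ∈ L.get i ∧ y ∈ L.get j

/-- Ordered set partitions `(S₁, …, S_k)` of `[n + 1]` (with nonempty blocks). -/
@[ext]
structure OrderedSetPartition (n : ℕ) where
  blocks : List (Finset (Fin (n + 1)))
  nonempty : ∀ A ∈ blocks, A.Nonempty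
  disjoint : blocks.Pairwise Disjoint
  cover : ∀ x, ∃ A ∈ blocks, x ∈ A

theorem weaklyBefore_cons {α : Type*} (A : Finset α) (L : List (Finset α)) (x y : α) :
    WeaklyBefore (A :: L) x y ↔
      (x ∈ A ∧ (y ∈ A ∨ ∃ C ∈ L, y ∈ C)) ∨ WeaklyBefore L x y := by
  constructor
  · rintro ⟨i, j, hij, hx, hy⟩
    induction i using Fin.cases with
    | zero =>
      left
      refine ⟨by simpa using hx, ?_⟩
      induction j using Fin.cases with
      | zero => left; simpa using hy
      | succ j => right; exact ⟨L.get j, L.get_mem j, by simpa using hy⟩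
    | succ i =>
      right
      induction j using Fin.cases with
      | zero => exact absurd hij (by simp)
      | succ j => exact ⟨i, j, by simpa using hij, by simpa using hx, by simpa using hy⟩
  · rintro (⟨hx, hy | ⟨C, hC, hy⟩⟩ | ⟨i, j, hij, hx, hy⟩)
    · exact ⟨⟨0, by simp⟩, ⟨0, by simp⟩, le_rfl, by simpa using hx, by simpa using hy⟩
    · obtain ⟨j, rfl⟩ := List.get_of_mem hC
      exact ⟨⟨0, by simp⟩, j.succ, Fin.mk_le_of_le_val (Nat.zero_le _), by simpa using hx,
        by simpa using hy⟩
    · exact ⟨i.succ, j.succ, by simpa using hij, by simpa using hx, by simpa using hy⟩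

theorem weaklyBefore_self {α : Type*} (L : List (Finset α)) (x : α) :
    WeaklyBefore L x x ↔ ∃ C ∈ L, x ∈ C := by
  induction L with
  | nil => simp [WeaklyBefore]
  | cons A L ih => rw [weaklyBefore_cons, ih]; simp; tauto

theorem WeaklyBefore.mem {α : Type*} {L : List (Finset α)} {x y : α} (h : WeaklyBefore L x y) :
    (∃ C ∈ L, x ∈ C) ∧ ∃ C ∈ L, y ∈ C := by
  obtain ⟨i, j, -, hx, hy⟩ := h
  exact ⟨⟨_, L.get_mem i, hx⟩, ⟨_, L.get_mem j, hy⟩⟩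

theorem eq_of_weaklyBefore_iff {α : Type*} :
    ∀ (L M : List (Finset α)), (∀ A ∈ L, A.Nonempty) → (∀ A ∈ M, A.Nonempty) →
      L.Pairwise Disjoint → M.Pairwise Disjoint →
      (∀ x y, WeaklyBefore L x y ↔ WeaklyBefore M x y) → L = M
  | [], [], _, _, _, _, _ => rfl
  | [], A :: M, _, hM, _, _, h => by
    obtain ⟨x, hx⟩ := hM A (by simp)
    have := (h x x).2 ((weaklyBefore_self _ _).2 ⟨A, by simp, hx⟩)
    simp [weaklyBefore_self] at this
  | A :: L, [], hL, _, _, _, h => by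
    obtain ⟨x, hx⟩ := hL A (by simp)
    have := (h x x).1 ((weaklyBefore_self _ _).2 ⟨A, by simp, hx⟩)
    simp [weaklyBefore_self] at this
  | A :: L, C :: M, hL, hM, dL, dM, h => by
    rw [List.pairwise_cons] at dL dM
    have nL : ∀ x ∈ A, ∀ D ∈ L, x ∉ D := fun x hx D hD hx' =>
      Finset.disjoint_left.1 (dL.1 D hD) hx hx'
    have nM : ∀ x ∈ C, ∀ D ∈ M, x ∉ D := fun x hx D hD hx' =>
      Finset.disjoint_left.1 (dM.1 D hD) hx hx'
    have supp : ∀ x, (x ∈ A ∨ ∃ D ∈ L, x ∈ D) ↔ (x ∈ C ∨ ∃ D ∈ M, x ∈ D) := fun x => by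
      have := h x x
      simpa [weaklyBefore_self] using this
    obtain ⟨a, ha⟩ := hL A (by simp)
    obtain ⟨c, hc⟩ := hM C (by simp)
    have key1 : ∀ x ∈ A, x ∈ C := fun x hx => by
      have h1 : WeaklyBefore (A :: L) x c :=
        (weaklyBefore_cons _ _ _ _).2 (Or.inl ⟨hx, (supp c).2 (Or.inl hc)⟩)
      rcases (weaklyBefore_cons _ _ _ _).1 ((h x c).1 h1) with h2 | h2
      · exact h2.1
      · obtain ⟨D, hD, hcD⟩ := h2.mem.2
        exact absurd hcD (nM c hc D hD)
    have key2 : ∀ x ∈ C, x ∈ A := fun x hx => by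
      have h1 : WeaklyBefore (C :: M) x a :=
        (weaklyBefore_cons _ _ _ _).2 (Or.inl ⟨hx, (supp a).1 (Or.inl ha)⟩)
      rcases (weaklyBefore_cons _ _ _ _).1 ((h x a).2 h1) with h2 | h2
      · exact h2.1
      · obtain ⟨D, hD, haD⟩ := h2.mem.2
        exact absurd haD (nL a ha D hD)
    have hAC : A = C := Finset.ext fun x => ⟨key1 x, key2 x⟩
    subst hAC
    congr 1
    refine eq_of_weaklyBefore_iff L M (fun D hD => hL D (by simp [hD]))
      (fun D hD => hM D (by simp [hD])) dL.2 dM.2 fun x y => ?_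
    constructor
    · intro hxy
      rcases (weaklyBefore_cons _ _ _ _).1
        ((h x y).1 ((weaklyBefore_cons _ _ _ _).2 (Or.inr hxy))) with h2 | h2
      · obtain ⟨D, hD, hxD⟩ := hxy.mem.1
        exact absurd hxD (nL x h2.1 D hD)
      · exact h2
    · intro hxy
      rcases (weaklyBefore_cons _ _ _ _).1
        ((h x y).2 ((weaklyBefore_cons _ _ _ _).2 (Or.inr hxy))) with h2 | h2
      · obtain ⟨D, hD, hxD⟩ := hxy.mem.1
        exact absurd hxD (nM x h2.1 D hD)
      · exact h2

/-- The poset `𝒪_d`. `S ≤ S'` means that `S` is a refinement of `S'` as an ordered partition, that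
is, `S'` arises from `S` by merging consecutive blocks: elements in the same block of `S` are in the
same block of `S'`, and if the block of `x` comes before that of `y` in `S`, then the block of `x`
comes before or equals that of `y` in `S'`. -/
instance (n : ℕ) : PartialOrder (OrderedSetPartition n) where
  le S S' := ∀ x y, WeaklyBefore S.blocks x y → WeaklyBefore S'.blocks x y
  le_refl _ _ _ h := h
  le_trans _ _ _ h h' x y hxy := h' x y (h x y hxy)
  le_antisymm S S' h h' := OrderedSetPartition.ext <|
    eq_of_weaklyBefore_iff _ _ S.nonempty S'.nonempty S.disjoint S'.disjoint
      fun x y => ⟨h x y, h' x y⟩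

/-- `Type(S) = {|S₁| + ⋯ + |S_m| : 1 ≤ m ≤ k - 1} ⊆ [d - 1]`
(the element `i : Fin n` stands for the number `i + 1`). -/
def OrderedSetPartition.typeSet {n : ℕ} (S : OrderedSetPartition n) : Finset (Fin n) :=
  Finset.univ.filter fun i =>
    ∃ m : Fin S.blocks.length, 1 ≤ (m : ℕ) ∧
      ((S.blocks.take m).map Finset.card).sum = (i : ℕ) + 1

/-- Every element of a block is smaller than every element of the next block. -/
def OrderedSetPartition.IsStandard {n : ℕ} (S : OrderedSetPartition n) : Prop :=
  S.blocks.IsChain fun A A' => ∀ x ∈ A, ∀ y ∈ A', x < y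

/-! ### Decorated ordered set partitions -/

/-- Decorated ordered set partitions `(S, B)` of `[d]`. -/
@[ext]
structure Decorated (n : ℕ) where
  part : OrderedSetPartition n
  deco : Finset (Fin n)
  deco_trivial : part.blocks.length = 1 → deco = Finset.univ
  deco_nontrivial : 1 < part.blocks.length → deco.Nonempty ∧ deco ⊆ part.typeSet

/-- The poset `ℱ_d`: `(S, B) ≤ (S', B')` iff `S ≤ S'` in `𝒪_d` and `B ⊆ B'`. -/
instance (n : ℕ) : PartialOrder (Decorated n) where
  le D D' := D.part ≤ D'.part ∧ D.deco ⊆ D'.deco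
  le_refl _ := ⟨le_rfl, subset_rfl⟩
  le_trans _ _ _ h h' := ⟨h.1.trans h'.1, h.2.trans h'.2⟩
  le_antisymm _ _ h h' := Decorated.ext (le_antisymm h.1 h'.1) (h.2.antisymm h'.2)

/-- `𝒵_d`: the subposet of the dual `𝒯_d` of `ℱ_d` induced on the `(S, B)` with `S` standard. -/
abbrev Z (n : ℕ) : Type :=
  {D : (Decorated n)ᵒᵈ // (OrderDual.ofDual D).part.IsStandard}

/-- The ordered set partition `S` of `(S, B) ∈ 𝒵_d`. -/
def Z.part {n : ℕ} (D : Z n) : OrderedSetPartition n := (OrderDual.ofDual D.1).part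

/-- The set `B` of `(S, B) ∈ 𝒵_d`. -/
def Z.deco {n : ℕ} (D : Z n) : Finset (Fin n) := (OrderDual.ofDual D.1).deco

/-- For a poset `F` and a map `lam` on `F`, the poset `F^lam` on `{(τ, lam τ) : τ ∈ F}` ordered by
`(τ, lam τ) ≤ (τ', lam τ')` iff `τ ≤ τ'` in `F`. -/
def LambdaPoset {F C : Type*} (lam : F → C) : Type _ := {p : F × C // p.2 = lam p.1}

instance {F C : Type*} [PartialOrder F] (lam : F → C) : PartialOrder (LambdaPoset lam) where
  le p q := p.1.1 ≤ q.1.1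
  le_refl p := le_refl p.1.1
  le_trans _ _ _ h h' := le_trans h h'
  le_antisymm p q h h' := by
    have h1 : p.1.1 = q.1.1 := le_antisymm h h'
    exact Subtype.ext (Prod.ext h1 (by rw [p.2, q.2, h1]))

/-! ### Geometry: the space `W_{d-1} = ℝ^d / 𝟏`, cones and fans -/

/-- `W_{d-1} = ℝ^d / ℝ𝟏`, the dual of `V_{d-1} = {x : ∑ x_i = 0}` and of its translates. -/
abbrev W (n : ℕ) : Type := (Fin (n + 1) → ℝ) ⧸ Submodule.span ℝ {(1 : Fin (n + 1) → ℝ)}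

/-- The functional `w ↦ w_j - w_i`, well defined on `W_{d-1}`. -/
def diff {n : ℕ} (i j : Fin (n + 1)) : W n →ₗ[ℝ] ℝ :=
  Submodule.liftQ _
    { toFun := fun w => w j - w i
      map_add' := fun v w => by simp only [Pi.add_apply]; ring
      map_smul' := fun c w => by simp [mul_sub] } (by
    rw [Submodule.span_le]
    rintro _ rfl
    simp)

/-- `δ_i(w) = w_{i+1} - w_i`, an entry of the first difference vector of `w`. -/
def delta {n : ℕ} (i : Fin n) : W n →ₗ[ℝ] ℝ := diff i.castSucc i.succ

/-- The pairing `⟨w, u⟩ = [w, u - x₀]` of `w ∈ W_{d-1}` with a point `u` of a translate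
`U = V_{d-1} + x₀` of `V_{d-1}`, where `[·,·]` is the dot product and `x₀ ∈ V_{d-1}^⊥ = ℝ𝟏`;
so every coordinate of `x₀` is the mean of the coordinates of `u`. -/
noncomputable def pairing {n : ℕ} (u : Fin (n + 1) → ℝ) : W n →ₗ[ℝ] ℝ :=
  Submodule.liftQ _
    (∑ j, (u j - (∑ k, u k) / (n + 1)) • (LinearMap.proj j : (Fin (n + 1) → ℝ) →ₗ[ℝ] ℝ)) (by
      rw [Submodule.span_le]
      rintro _ rfl
      have h : ((n : ℝ) + 1) ≠ 0 := by positivity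
      simp [LinearMap.sum_apply, Finset.sum_sub_distrib]
      field_simp
      ring)

/-- The nonempty faces of a polyhedron `P`: the nonempty sets of maximizers over `P` of a linear
functional. As a subtype of `Set E` it is ordered by inclusion. -/
def faces {E : Type*} [AddCommGroup E] [Module ℝ E] [TopologicalSpace E] (P : Set E) :
    Set (Set E) :=
  {F | F.Nonempty ∧ IsExposed ℝ P F}

/-- The normal cone of `P` at `F` with respect to `W_{d-1}`. -/
def ncone {n : ℕ} (F P : Set (Fin (n + 1) → ℝ)) : Set (W n) :=
  {w | ∀ y ∈ F, ∀ y' ∈ P, pairing y' w ≤ pairing y w}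

/-- The normal fan `Σ(P)` of a polytope `P` with respect to `W_{d-1}`. -/
def normalFan {n : ℕ} (P : Set (Fin (n + 1) → ℝ)) : Set (Set (W n)) :=
  {σ | ∃ F ∈ faces P, σ = ncone F P}

/-- The fundamental chamber `Φ_{d-1}`, the set of `w` with `w₁ ≤ w₂ ≤ ⋯ ≤ w_d`. -/
def Phi (n : ℕ) : Set (W n) := {w | ∀ i j, i ≤ j → 0 ≤ diff i j w}

/-- `Ω(P)`: the pairs `(σ, φ) ∈ Σ(P) × Σ(Φ)` whose relative interiors meet, where `Σ(Φ)` is the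
set of nonempty faces of `Φ`. The order of the subtype is
`(σ, φ) ≤ (σ', φ')` iff `σ ⊆ σ'` and `φ ⊆ φ'`. -/
def Omega {n : ℕ} (P : Set (Fin (n + 1) → ℝ)) : Set (Set (W n) × Set (W n)) :=
  {p | p.1 ∈ normalFan P ∧ p.2 ∈ faces (Phi n) ∧
    (intrinsicInterior ℝ p.1 ∩ intrinsicInterior ℝ p.2).Nonempty}

/-- The cone `σ_S`: `w_i = w_j` for `i, j` in the same block, and `w_i ≤ w_j` for `i` in an earlier
block than `j`. -/
def sigmaCone {n : ℕ} (S : OrderedSetPartition n) : Set (W n) :=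
  {w | (∀ A ∈ S.blocks, ∀ i ∈ A, ∀ j ∈ A, diff i j w = 0) ∧
    ∀ a b : Fin S.blocks.length, a < b →
      ∀ i ∈ S.blocks.get a, ∀ j ∈ S.blocks.get b, 0 ≤ diff i j w}

/-- The cone `ν_B`. -/
def nuCone {n : ℕ} (B : Finset (Fin n)) : Set (W n) :=
  {w | (∀ i ∈ B, ∀ j ∈ B, delta i w = delta j w) ∧
    ∀ i, i ∉ B → ∀ j ∈ B, delta i w ≤ delta j w}

/-- The map `λ(S, B) = σ_S` on `𝒵_d`. -/
def lam {n : ℕ} (D : Z n) : Set (W n) := sigmaCone D.part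

/-! ### The polytope and its symmetrization -/

/-- `a_i = -e_i + e_{i+1}`. -/
def rootVec {n : ℕ} (i : Fin n) : Fin (n + 1) → ℝ :=
  -Pi.single i.castSucc 1 + Pi.single i.succ 1

/-- The affine map `T_γ(x) = γ + ∑ x_i a_i`. -/
def T {n : ℕ} (γ : Fin (n + 1) → ℝ) (x : Fin n → ℝ) : Fin (n + 1) → ℝ :=
  γ + ∑ i, x i • rootVec i

/-- `γ₀ = (1², 2², …, d²)`. -/
def gamma0 (n : ℕ) : Fin (n + 1) → ℝ := fun j => ((j : ℝ) + 1) ^ 2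

/-- The standard simplex `Δ_{d-2} = Conv{e₁, …, e_{d-1}}` in `ℝ^{d-1}`. -/
def simplex (n : ℕ) : Set (Fin n → ℝ) :=
  convexHull ℝ (Set.range fun i : Fin n => (Pi.single i 1 : Fin n → ℝ))

/-- `P = T_{γ₀}(Δ_{d-2})`. -/
def polytopeP (n : ℕ) : Set (Fin (n + 1) → ℝ) := T (gamma0 n) '' simplex n

/-- The left action `π(x) = (x_{π⁻¹(1)}, …, x_{π⁻¹(d)})` of `𝔖_d` on `ℝ^d`. -/
def permAct {n : ℕ} (π : Equiv.Perm (Fin (n + 1))) (x : Fin (n + 1) → ℝ) : Fin (n + 1) → ℝ :=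
  fun j => x (π⁻¹ j)

/-- The `𝔖_d`-symmetrization `Conv{x · π : π ∈ 𝔖_d, x ∈ P}`, where
`x · π = (x_{π(1)}, …, x_{π(d)})`. -/
def symmetrization {n : ℕ} (P : Set (Fin (n + 1) → ℝ)) : Set (Fin (n + 1) → ℝ) :=
  convexHull ℝ {y | ∃ π : Equiv.Perm (Fin (n + 1)), ∃ x ∈ P, y = fun j => x (π j)}

end HybridPoset

/-! Symmetrization. Its generators are the permuted points `vtx i ∘ ρ`. Every `vtx i` is strictly
increasing, so by the rearrangement inequality a vector `w`, paired with these points for fixed `i`,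
is maximal exactly at the permutations `ρ` that sort `w`, and the maximum is a term independent of
`i` plus the `i`-th gap of the sorted `w` (`sum_mul_vtx_comp_perm`, `maximal_iff_compat`). The face
in direction `w` is thus determined by the ordered partition of `[d]` into level sets of `w` and the
set `B` of positions of maximal gap. Gaps are positive exactly at the type of the partition, so `B`
lies in the type unless `w` is constant, when `B` is everything. These pairs are precisely the
decorated partitions (`exists_rep`, `exists_decorated`), and inclusion of faces is their order
(`face_subset_face_iff`, `compat_imp_iff`).

The poset `Ω(P)`. The differences `δ_i` are coordinates on `W`. There `Φ` is the nonnegative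
orthant, with faces indexed by subsets `C` of `[d-1]`, and `σ_S` is the face with `C` the type of
`S`. Up to a common term the vertices of `P` pair with `w` to `δ_i(w)`, so the normal cones are the
`ν_B` with `B` nonempty. The relative interiors of `ν_B` and of the face of `C` meet exactly when
`B` is an admissible decoration for type `C` (`interiors_meet_iff`). -/

namespace HybridPoset

/-! ### Block indices -/

/-- If `u` and `v` are monotone and `v` only jumps where `u` does, then `v` is a weakly increasing
function of `u`. -/
theorem le_of_le_of_step {n : ℕ} {α β : Type*} [LinearOrder α] [LinearOrder β]
    {u : Fin (n + 1) → α} {v : Fin (n + 1) → β} (hu : Monotone u) (hv : Monotone v)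
    (h : ∀ i : Fin n, u i.castSucc = u i.succ → v i.castSucc = v i.succ) {k l : Fin (n + 1)}
    (hkl : u k ≤ u l) : v k ≤ v l := by
  rcases le_total k l with hk | hk
  · exact hv hk
  -- When `l ≤ k`, monotonicity forces `u` to be constant between them, so `v` has no jump there.
  have key : ∀ m : Fin (n + 1), l ≤ m → u m = u l → v m = v l := by
    intro m
    induction m using Fin.induction with
    | zero =>
      intro hl _
      rw [Fin.le_zero_iff.1 hl]
    | succ m ih =>
      intro hl hm
      rcases hl.eq_or_lt with rfl | hl
      · rfl
      have hl' : l ≤ m.castSucc := Fin.le_castSucc_iff.2 hl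
      have h1 : u m.castSucc = u l :=
        le_antisymm (hm ▸ hu (Fin.castSucc_lt_succ (i := m)).le) (hu hl')
      rw [← h m (h1.trans hm.symm), ih hl' h1]
  exact (key k hk (le_antisymm hkl (hu hk))).le

namespace OrderedSetPartition

variable {n : ℕ} (S : OrderedSetPartition n)

theorem exists_mem_get (x : Fin (n + 1)) : ∃ i : Fin S.blocks.length, x ∈ S.blocks.get i := by
  obtain ⟨A, hA, hx⟩ := S.cover x
  obtain ⟨i, rfl⟩ := List.get_of_mem hA
  exact ⟨i, hx⟩

/-- The index of the block containing `x`. -/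
noncomputable def idx (x : Fin (n + 1)) : Fin S.blocks.length := (S.exists_mem_get x).choose

theorem mem_get_iff {x : Fin (n + 1)} {i : Fin S.blocks.length} :
    x ∈ S.blocks.get i ↔ S.idx x = i := by
  have hx : x ∈ S.blocks.get (S.idx x) := (S.exists_mem_get x).choose_spec
  refine ⟨fun h => ?_, fun h => h ▸ hx⟩
  by_contra hne
  rcases lt_or_gt_of_ne hne with hlt | hlt
  · exact Finset.disjoint_left.1 (List.pairwise_iff_get.1 S.disjoint _ _ hlt) hx h
  · exact Finset.disjoint_left.1 (List.pairwise_iff_get.1 S.disjoint _ _ hlt) h hx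

theorem weaklyBefore_iff {x y : Fin (n + 1)} :
    WeaklyBefore S.blocks x y ↔ S.idx x ≤ S.idx y := by
  constructor
  · rintro ⟨i, j, hij, hx, hy⟩
    rwa [S.mem_get_iff.1 hx, S.mem_get_iff.1 hy]
  · exact fun h => ⟨_, _, h, S.mem_get_iff.2 rfl, S.mem_get_iff.2 rfl⟩

theorem exists_idx_eq (i : Fin S.blocks.length) : ∃ x, S.idx x = i := by
  obtain ⟨x, hx⟩ := S.nonempty _ (S.blocks.get_mem i)
  exact ⟨x, S.mem_get_iff.1 hx⟩

theorem sum_card_take (m : ℕ) (hm : m ≤ S.blocks.length) :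
    ((S.blocks.take m).map Finset.card).sum =
      (Finset.univ.filter fun x => (S.idx x : ℕ) < m).card := by
  induction m with
  | zero => simp
  | succ m ih =>
    have hd : Disjoint (Finset.univ.filter fun x => (S.idx x : ℕ) < m)
        (S.blocks.get ⟨m, hm⟩) := by
      rw [Finset.disjoint_left]
      intro x hx hx'
      rw [S.mem_get_iff] at hx'
      simp [hx'] at hx
    have hu : (Finset.univ.filter fun x => (S.idx x : ℕ) < m + 1) =
        (Finset.univ.filter fun x => (S.idx x : ℕ) < m) ∪ S.blocks.get ⟨m, hm⟩ := by
      ext x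
      rw [Finset.mem_union, S.mem_get_iff, Fin.ext_iff]
      simp only [Finset.mem_filter, Finset.mem_univ, true_and]
      omega
    rw [hu, Finset.card_union_of_disjoint hd, ← ih (Nat.le_of_succ_le hm),
      List.take_succ_eq_append_getElem hm, List.map_append, List.sum_append]
    rfl

/-- A position is in the type iff the block index jumps there, for any enumeration of the elements
that is compatible with the order of the blocks. -/
theorem mem_typeSet_iff {σ : Equiv.Perm (Fin (n + 1))} (hσ : Monotone (S.idx ∘ σ)) {i : Fin n} :
    i ∈ S.typeSet ↔ S.idx (σ i.castSucc) < S.idx (σ i.succ) := by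
  have hmono : Monotone fun k => (S.idx (σ k) : ℕ) := fun a b hab => hσ hab
  -- Along `σ` the positions with block index below `m` form an initial segment; it has `i + 1`
  -- elements iff it contains `i.castSucc` but not `i.succ`.
  have hcard : ∀ m ≤ S.blocks.length, ((S.blocks.take m).map Finset.card).sum = (i : ℕ) + 1 ↔
      (S.idx (σ i.castSucc) : ℕ) < m ∧ m ≤ S.idx (σ i.succ) := by
    intro m hm
    have hc : (Finset.univ.filter fun x => (S.idx x : ℕ) < m).card =
        (Finset.univ.filter fun k => (S.idx (σ k) : ℕ) < m).card := by
      refine (Finset.card_equiv σ fun k => ?_).symm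
      simp
    have h1 := Tuple.lt_card_lt_iff_apply_lt_of_monotone (j := i.castSucc) (a := m) hmono
    have h2 := Tuple.lt_card_lt_iff_apply_lt_of_monotone (j := i.succ) (a := m) hmono
    rw [S.sum_card_take m hm, hc, ← h1, ← not_lt, ← h2, Fin.val_castSucc, Fin.val_succ]
    omega
  simp only [typeSet, Finset.mem_filter, Finset.mem_univ, true_and]
  constructor
  · rintro ⟨m, -, h⟩
    obtain ⟨h1, h2⟩ := (hcard m m.2.le).1 h
    exact Fin.lt_def.2 (h1.trans_le h2)
  · intro h
    exact ⟨S.idx (σ i.succ), Nat.one_le_of_lt (Fin.lt_def.1 h),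
      (hcard _ (Fin.is_lt _).le).2 ⟨h, le_rfl⟩⟩

theorem length_eq_one_iff : S.blocks.length = 1 ↔ ∀ x y, S.idx x = S.idx y := by
  constructor
  · intro h x y
    have := (S.idx x).2
    have := (S.idx y).2
    exact Fin.ext (by omega)
  · intro h
    have h0 := (S.idx 0).2
    by_contra hne
    obtain ⟨x, hx⟩ := S.exists_idx_eq ⟨0, by omega⟩
    obtain ⟨y, hy⟩ := S.exists_idx_eq ⟨1, by omega⟩
    have := h x y
    simp [hx, hy] at this

theorem length_pos : 0 < S.blocks.length := (S.idx 0).pos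

theorem typeSet_eq_empty_iff : S.typeSet = ∅ ↔ S.blocks.length = 1 := by
  rw [length_eq_one_iff]
  have hσ := Tuple.monotone_sort S.idx
  constructor
  · intro h x y
    have hanti : Antitone (S.idx ∘ Tuple.sort S.idx) := by
      rw [Fin.antitone_iff_succ_le]
      intro i
      have : i ∉ S.typeSet := by simp [h]
      rw [S.mem_typeSet_iff hσ] at this
      exact not_lt.1 this
    have hc : ∀ k l, (S.idx ∘ Tuple.sort S.idx) k = (S.idx ∘ Tuple.sort S.idx) l := fun k l => by
      rcases le_total k l with h | h
      · exact le_antisymm (hσ h) (hanti h)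
      · exact le_antisymm (hanti h) (hσ h)
    simpa using hc ((Tuple.sort S.idx).symm x) ((Tuple.sort S.idx).symm y)
  · intro h
    ext i
    simp [S.mem_typeSet_iff hσ, h (Tuple.sort S.idx i.castSucc) (Tuple.sort S.idx i.succ)]

/-! ### The ordered set partition of a vector -/

/-- The partition into level sets of `w`, ordered by increasing value. -/
noncomputable def ofFun (w : Fin (n + 1) → ℝ) : OrderedSetPartition n where
  blocks := ((Finset.univ.image w).sort (· ≤ ·)).map fun v => Finset.univ.filter (w · = v)
  nonempty A hA := by
    obtain ⟨v, hv, rfl⟩ := List.mem_map.1 hA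
    obtain ⟨x, -, hx⟩ := Finset.mem_image.1 ((Finset.mem_sort _).1 hv)
    exact ⟨x, by simpa using hx⟩
  disjoint := by
    rw [List.pairwise_map]
    refine (Finset.sort_nodup _ _).imp fun {a b} hab => ?_
    rw [Finset.disjoint_left]
    intro x hx hx'
    exact hab (by rw [← (Finset.mem_filter.1 hx).2, (Finset.mem_filter.1 hx').2])
  cover x := ⟨Finset.univ.filter (w · = w x), List.mem_map.2 ⟨w x, by simp, rfl⟩, by simp⟩

theorem ofFun_idx_le_iff (w : Fin (n + 1) → ℝ) (x y : Fin (n + 1)) :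
    (ofFun w).idx x ≤ (ofFun w).idx y ↔ w x ≤ w y := by
  have hlen : (ofFun w).blocks.length = ((Finset.univ.image w).sort (· ≤ ·)).length := by
    simp [ofFun]
  -- The block index of `x` is the place of `w x` in the sorted list of values.
  have hx : ∀ x, w x = ((Finset.univ.image w).sort (· ≤ ·)).get
      (((ofFun w).idx x).cast hlen) := by
    intro x
    have := (ofFun w).mem_get_iff.2 (rfl : (ofFun w).idx x = _)
    simp only [ofFun, List.get_eq_getElem, List.getElem_map, Finset.mem_filter, Finset.mem_univ,
      true_and] at this
    exact this
  have hs : StrictMono ((Finset.univ.image w).sort (· ≤ ·)).get :=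
    (Finset.sortedLT_sort (Finset.univ.image w)).strictMono_get
  rw [hx x, hx y, hs.le_iff_le]
  rfl

end OrderedSetPartition

end HybridPoset

/-! ### Faces of the symmetrization and decorated partitions -/

namespace HybridPoset

/-! ### Exposed faces of convex hulls -/

section Faces

variable {E : Type*} [AddCommGroup E] [Module ℝ E]

/-- The points that lie strictly below level `M` or in the hull of the maximal generators form a
convex set containing `V`, hence containing its hull. -/
theorem mem_convexHull_of_maximal {V : Set E} (l : E →ₗ[ℝ] ℝ) {M : ℝ} (hM : ∀ v ∈ V, l v ≤ M)
    {x : E} (hx : x ∈ convexHull ℝ V) (hlx : M ≤ l x) :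
    x ∈ convexHull ℝ {v ∈ V | l v = M} := by
  set K := convexHull ℝ {v ∈ V | l v = M} with hK
  have hlK : ∀ y ∈ K, l y = M := fun y hy =>
    convexHull_min (fun v hv => hv.2 : {v ∈ V | l v = M} ⊆ {y | l y = M})
      (convex_hyperplane l.isLinear M) hy
  have hconv : Convex ℝ {y | l y < M ∨ y ∈ K} := by
    intro y hy z hz a b ha hb hab
    have hly : l y ≤ M := hy.elim le_of_lt fun h => (hlK y h).le
    have hlz : l z ≤ M := hz.elim le_of_lt fun h => (hlK z h).le
    rcases ha.eq_or_lt with rfl | ha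
    · simpa [show b = 1 by linarith] using hz
    rcases hb.eq_or_lt with rfl | hb
    · simpa [show a = 1 by linarith] using hy
    have hM : M = a * M + b * M := by rw [← add_mul, hab, one_mul]
    rcases hy with hy | hy
    · left
      simp only [map_add, map_smul, smul_eq_mul]
      nlinarith
    rcases hz with hz | hz
    · left
      simp only [map_add, map_smul, smul_eq_mul]
      nlinarith
    · exact Or.inr (convex_convexHull ℝ _ hy hz ha.le hb.le hab)
  have hsub : V ⊆ {y | l y < M ∨ y ∈ K} := fun v hv =>
    (hM v hv).lt_or_eq.imp id fun h => subset_convexHull ℝ _ ⟨hv, h⟩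
  exact (convexHull_min hsub hconv hx).resolve_left hlx.not_gt

/-- The face of a polytope at which a linear functional is maximal is the convex hull of the
generators at which it is maximal. -/
theorem maximizers_convexHull_range {ι : Type*} [Finite ι] [Nonempty ι] (l : E →ₗ[ℝ] ℝ)
    (p : ι → E) :
    {x | x ∈ convexHull ℝ (Set.range p) ∧ ∀ y ∈ convexHull ℝ (Set.range p), l y ≤ l x} =
      convexHull ℝ (p '' {i | ∀ j, l (p j) ≤ l (p i)}) := by
  obtain ⟨i₀, hi₀⟩ := Finite.exists_max fun i => l (p i)
  have hle : ∀ y ∈ convexHull ℝ (Set.range p), l y ≤ l (p i₀) := fun y hy =>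
    convexHull_min (by rintro _ ⟨i, rfl⟩; exact hi₀ i : Set.range p ⊆ {y | l y ≤ l (p i₀)})
      (convex_halfSpace_le l.isLinear _) hy
  have hset : {v ∈ Set.range p | l v = l (p i₀)} = p '' {i | ∀ j, l (p j) ≤ l (p i)} := by
    ext v
    constructor
    · rintro ⟨⟨i, rfl⟩, hi⟩
      exact ⟨i, fun j => (hi₀ j).trans hi.ge, rfl⟩
    · rintro ⟨i, hi, rfl⟩
      exact ⟨⟨i, rfl⟩, le_antisymm (hi₀ i) (hi i₀)⟩
  rw [← hset]
  ext x
  constructor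
  · rintro ⟨hx, hmax⟩
    exact mem_convexHull_of_maximal l (by rintro _ ⟨i, rfl⟩; exact hi₀ i) hx
      (hmax _ (subset_convexHull ℝ _ ⟨i₀, rfl⟩))
  · intro hx
    refine ⟨convexHull_mono (fun v hv => hv.1) hx, fun y hy => ?_⟩
    rw [convexHull_min (fun v hv => hv.2 :
      {v ∈ Set.range p | l v = l (p i₀)} ⊆ {y | l y = l (p i₀)})
      (convex_hyperplane l.isLinear _) hx]
    exact hle y hy

theorem faces_convexHull_range [TopologicalSpace E] {ι : Type*} [Finite ι] [Nonempty ι]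
    (p : ι → E) {F : Set E} :
    F ∈ faces (convexHull ℝ (Set.range p)) ↔
      ∃ l : StrongDual ℝ E, F = convexHull ℝ (p '' {i | ∀ j, l (p j) ≤ l (p i)}) := by
  constructor
  · rintro ⟨hne, hF⟩
    obtain ⟨l, hl⟩ := hF hne
    exact ⟨l, hl.trans (maximizers_convexHull_range l.toLinearMap p)⟩
  · rintro ⟨l, rfl⟩
    obtain ⟨i₀, hi₀⟩ := Finite.exists_max fun i => l (p i)
    exact ⟨⟨p i₀, subset_convexHull ℝ _ ⟨i₀, hi₀, rfl⟩⟩,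
      fun _ => ⟨l, (maximizers_convexHull_range l.toLinearMap p).symm⟩⟩

end Faces

/-! ### The generators of the symmetrization -/

variable {n : ℕ}

/-- The generator `γ₀ + a_i` of `P`. -/
def vtx (i : Fin n) : Fin (n + 1) → ℝ := gamma0 n + rootVec i

theorem sum_mul_rootVec (v : Fin (n + 1) → ℝ) (i : Fin n) :
    ∑ k, v k * rootVec i k = v i.succ - v i.castSucc := by
  simp [rootVec, mul_add, Finset.sum_add_distrib, Pi.single_apply]
  ring

theorem sum_mul_vtx (v : Fin (n + 1) → ℝ) (i : Fin n) :
    ∑ k, v k * vtx i k = ∑ k, v k * gamma0 n k + (v i.succ - v i.castSucc) := by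
  simp [vtx, mul_add, Finset.sum_add_distrib, sum_mul_rootVec]

/-- Consecutive squares differ by at least 3, and adding `a_i` moves each coordinate by at most 1.
Strictness makes the equality case of the rearrangement inequality sharp. -/
theorem vtx_strictMono (i : Fin n) : StrictMono (vtx i) := by
  rw [Fin.strictMono_iff_lt_succ]
  intro j
  have h1 : rootVec i j.castSucc ≤ 1 := by
    simp only [rootVec, Pi.add_apply, Pi.neg_apply, Pi.single_apply]
    split_ifs <;> norm_num
  have h2 : -1 ≤ rootVec i j.succ := by
    simp only [rootVec, Pi.add_apply, Pi.neg_apply, Pi.single_apply]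
    split_ifs <;> norm_num
  have hj : (0 : ℝ) ≤ (j : ℕ) := Nat.cast_nonneg _
  simp only [vtx, gamma0, Pi.add_apply, Fin.val_castSucc, Fin.val_succ, Nat.cast_add, Nat.cast_one]
  nlinarith

theorem polytopeP_eq : polytopeP n = convexHull ℝ (Set.range (vtx (n := n))) := by
  have hT : T (gamma0 n) = fun x : Fin n → ℝ => gamma0 n + (Fintype.linearCombination ℝ rootVec) x := by
    ext x
    simp [T, Fintype.linearCombination_apply]
  let A : (Fin n → ℝ) →ᵃ[ℝ] (Fin (n + 1) → ℝ) :=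
    (AffineMap.const ℝ _ (gamma0 n)) + (Fintype.linearCombination ℝ rootVec).toAffineMap
  have hA : T (gamma0 n) = A := by rw [hT]; rfl
  rw [polytopeP, simplex, hA, A.image_convexHull, ← hA, ← Set.range_comp]
  congr 2
  ext i : 1
  simp [T, vtx, Pi.single_apply]

theorem symmetrization_polytopeP :
    symmetrization (polytopeP n) = convexHull ℝ (Set.range
      fun q : Equiv.Perm (Fin (n + 1)) × Fin n => vtx q.2 ∘ q.1) := by
  apply subset_antisymm
  · refine convexHull_min ?_ (convex_convexHull ℝ _)
    rintro _ ⟨π, x, hx, rfl⟩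
    rw [polytopeP_eq] at hx
    have h := Set.mem_image_of_mem (LinearMap.funLeft ℝ ℝ π) hx
    rw [LinearMap.image_convexHull, ← Set.range_comp] at h
    refine convexHull_mono ?_ h
    rintro _ ⟨i, rfl⟩
    exact ⟨(π, i), rfl⟩
  · refine convexHull_mono ?_
    rintro _ ⟨⟨π, i⟩, rfl⟩
    exact ⟨π, vtx i, by rw [polytopeP_eq]; exact subset_convexHull ℝ _ ⟨i, rfl⟩, rfl⟩

theorem symmetrization_generators :
    {y | ∃ (π : Equiv.Perm (Fin (n + 1))) (i : Fin n),
        y = permAct π (gamma0 n) + permAct π (rootVec i)} =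
      Set.range fun q : Equiv.Perm (Fin (n + 1)) × Fin n => vtx q.2 ∘ q.1 := by
  ext y
  constructor
  · rintro ⟨π, i, rfl⟩
    -- The left action precomposes with the inverse.
    exact ⟨(π⁻¹, i), rfl⟩
  · rintro ⟨⟨π, i⟩, rfl⟩
    exact ⟨π⁻¹, i, by ext; simp [permAct, vtx]⟩

/-! ### Faces of the symmetrization -/

/-- The successive differences of the increasing rearrangement of `w`. -/
noncomputable def gap (w : Fin (n + 1) → ℝ) (i : Fin n) : ℝ :=
  w (Tuple.sort w i.succ) - w (Tuple.sort w i.castSucc)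

/-- Ties allow several sorting permutations, but the sorted vector is unique. -/
theorem gap_of_monotone {w : Fin (n + 1) → ℝ} {σ : Equiv.Perm (Fin (n + 1))}
    (h : Monotone (w ∘ σ)) (i : Fin n) : gap w i = w (σ i.succ) - w (σ i.castSucc) := by
  have := Tuple.comp_sort_eq_comp_iff_monotone.2 h
  simp only [funext_iff, Function.comp_apply] at this
  rw [gap, this, this]

theorem gap_nonneg (w : Fin (n + 1) → ℝ) (i : Fin n) : 0 ≤ gap w i :=
  sub_nonneg.2 (Tuple.monotone_sort w Fin.castSucc_lt_succ.le)

/-- The pairs of a permutation and a position at which `w` attains its maximum on the generators. -/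
def Compat (w : Fin (n + 1) → ℝ) (q : Equiv.Perm (Fin (n + 1)) × Fin n) : Prop :=
  (∀ x y, q.1 x < q.1 y → w x ≤ w y) ∧ ∀ j, gap w j ≤ gap w q.2

theorem sum_sort_mul_vtx (w : Fin (n + 1) → ℝ) (i : Fin n) :
    ∑ k, w (Tuple.sort w k) * vtx i k =
      ∑ k, w (Tuple.sort w k) * gamma0 n k + gap w i :=
  sum_mul_vtx (fun k => w (Tuple.sort w k)) i

/-- Rearrangement inequality with its equality case, after reindexing by a permutation that sorts
`w`; `ρ x` acts as the rank of `x`. -/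
theorem sum_mul_vtx_comp_perm (w : Fin (n + 1) → ℝ) (ρ : Equiv.Perm (Fin (n + 1))) (i : Fin n) :
    ∑ x, w x * vtx i (ρ x) ≤ ∑ k, w (Tuple.sort w k) * gamma0 n k + gap w i ∧
    (∑ x, w x * vtx i (ρ x) = ∑ k, w (Tuple.sort w k) * gamma0 n k + gap w i ↔
      ∀ x y, ρ x < ρ y → w x ≤ w y) := by
  have hmv : Monovary (w ∘ Tuple.sort w) (vtx i) := fun a b hab =>
    Tuple.monotone_sort w ((vtx_strictMono i).lt_iff_lt.1 hab).le
  have hs : ∑ x, w x * vtx i (ρ x) =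
      ∑ k, (w ∘ Tuple.sort w) k * vtx i ((ρ * Tuple.sort w) k) :=
    (Equiv.sum_comp (Tuple.sort w) fun x => w x * vtx i (ρ x)).symm
  rw [hs, ← sum_sort_mul_vtx]
  refine ⟨hmv.sum_mul_comp_perm_le_sum_mul, hmv.sum_mul_comp_perm_eq_sum_mul_iff.trans ?_⟩
  constructor
  · intro h x y hxy
    have := @h ((Tuple.sort w).symm x) ((Tuple.sort w).symm y)
      ((vtx_strictMono i).lt_iff_lt.2 (by simpa using hxy))
    simpa using this
  · intro h a b hab
    exact h _ _ ((vtx_strictMono i).lt_iff_lt.1 hab)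

theorem exists_compat [NeZero n] (w : Fin (n + 1) → ℝ) : ∃ q, Compat w q := by
  obtain ⟨i, hi⟩ := Finite.exists_max (gap w)
  refine ⟨((Tuple.sort w).symm, i), fun x y hxy => ?_, hi⟩
  simpa using Tuple.monotone_sort w hxy.le

/-- The bound for each position is attained by any sorting permutation, so the permutation and the
position are optimized independently. -/
theorem maximal_iff_compat [NeZero n] (w : Fin (n + 1) → ℝ)
    (q : Equiv.Perm (Fin (n + 1)) × Fin n) :
    (∀ q' : Equiv.Perm (Fin (n + 1)) × Fin n,
      ∑ x, w x * vtx q'.2 (q'.1 x) ≤ ∑ x, w x * vtx q.2 (q.1 x)) ↔ Compat w q := by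
  obtain ⟨q₀, hq₀⟩ := exists_compat w
  have h₀ := (sum_mul_vtx_comp_perm w q₀.1 q₀.2).2.2 hq₀.1
  have hq := sum_mul_vtx_comp_perm w q.1 q.2
  constructor
  · intro h
    have h1 := h q₀
    have h2 := hq₀.2 q.2
    exact ⟨hq.2.1 (by linarith [hq.1]), fun j => (hq₀.2 j).trans (by linarith [hq.1])⟩
  · intro h q'
    linarith [hq.2.2 h.1, (sum_mul_vtx_comp_perm w q'.1 q'.2).1, h.2 q'.2]

/-- The face of the symmetrization in direction `w`. -/
def face (w : Fin (n + 1) → ℝ) : Set (Fin (n + 1) → ℝ) :=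
  convexHull ℝ ((fun q : Equiv.Perm (Fin (n + 1)) × Fin n => vtx q.2 ∘ q.1) '' {q | Compat w q})

theorem mem_faces_iff [NeZero n] {F : Set (Fin (n + 1) → ℝ)} :
    F ∈ faces (symmetrization (polytopeP n)) ↔ ∃ w, F = face w := by
  rw [symmetrization_polytopeP, faces_convexHull_range]
  have key : ∀ (w : Fin (n + 1) → ℝ) (l : StrongDual ℝ (Fin (n + 1) → ℝ)),
      (∀ v, l v = ∑ x, w x * v x) → convexHull ℝ
      ((fun q : Equiv.Perm (Fin (n + 1)) × Fin n => vtx q.2 ∘ q.1) ''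
        {q | ∀ q' : Equiv.Perm (Fin (n + 1)) × Fin n,
          l (vtx q'.2 ∘ q'.1) ≤ l (vtx q.2 ∘ q.1)}) = face w := by
    intro w l hl
    simp only [hl, Function.comp_apply, maximal_iff_compat, face]
  constructor
  · rintro ⟨l, rfl⟩
    refine ⟨fun x => l (Pi.single x 1), key _ l fun v => ?_⟩
    conv_lhs => rw [pi_eq_sum_univ' v, map_sum]
    refine Finset.sum_congr rfl fun x _ => ?_
    rw [map_smul, smul_eq_mul, mul_comm]
  · rintro ⟨w, rfl⟩
    let l : StrongDual ℝ (Fin (n + 1) → ℝ) :=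
      ∑ x, w x • ContinuousLinearMap.proj (R := ℝ) (φ := fun _ : Fin (n + 1) => ℝ) x
    exact ⟨l, (key w l fun v => by simp [l]).symm⟩

/-- A generator lying in `face w'` maximizes `w'`, hence is itself compatible with `w'`; the hull
picks up no further generators. -/
theorem face_subset_face_iff [NeZero n] {w w' : Fin (n + 1) → ℝ} :
    face w ⊆ face w' ↔ ∀ q, Compat w q → Compat w' q := by
  constructor
  · intro h q hq
    obtain ⟨q₀, hq₀⟩ := exists_compat w'
    have hmem := h (subset_convexHull ℝ _ ⟨q, hq, rfl⟩)
    let l : (Fin (n + 1) → ℝ) →ₗ[ℝ] ℝ := ∑ x, w' x • LinearMap.proj x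
    have hl : ∀ v, l v = ∑ x, w' x * v x := fun v => by simp [l]
    have hle : ∀ y ∈ face w', l (vtx q₀.2 ∘ q₀.1) ≤ l y := fun y hy => by
      refine convexHull_min (t := {y | l (vtx q₀.2 ∘ q₀.1) ≤ l y}) ?_
        (convex_halfSpace_ge l.isLinear _) hy
      rintro _ ⟨q', hq', rfl⟩
      simpa [hl] using (maximal_iff_compat w' q').2 hq' q₀
    refine (maximal_iff_compat w' q).1 fun q' => ?_
    refine ((maximal_iff_compat w' q₀).2 hq₀ q').trans ?_
    simpa [hl] using hle _ hmem
  · exact fun h => convexHull_mono (Set.image_mono h)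

/-! ### Decorated ordered set partitions and directions -/

/-- `w` lies in the relative interior of the normal cone belonging to `D`. -/
def Rep (D : Decorated n) (w : Fin (n + 1) → ℝ) : Prop :=
  (∀ x y, D.part.idx x ≤ D.part.idx y ↔ w x ≤ w y) ∧
    ∀ i, i ∈ D.deco ↔ ∀ j, gap w j ≤ gap w i

theorem compat_imp_iff [NeZero n] {D D' : Decorated n} {w w' : Fin (n + 1) → ℝ} (h : Rep D w)
    (h' : Rep D' w') : (∀ q, Compat w q → Compat w' q) ↔ D ≤ D' := by
  have hle : D ≤ D' ↔ (∀ x y, w x ≤ w y → w' x ≤ w' y) ∧ D.deco ⊆ D'.deco := by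
    change (∀ x y, _ → _) ∧ _ ↔ _
    simp only [OrderedSetPartition.weaklyBefore_iff, h.1, h'.1]
  rw [hle]
  constructor
  · intro H
    obtain ⟨q₀, hq₀⟩ := exists_compat w
    refine ⟨fun x y hxy => ?_, fun i hi => (h'.2 i).2 (H (q₀.1, i) ⟨hq₀.1, (h.2 i).1 hi⟩).2⟩
    -- Sorting by `w` with ties broken in favour of `x` gives a permutation compatible with `w` that
    -- ranks `x` no later than `y`.
    let f : Fin (n + 1) → ℝ ×ₗ ℕ := fun z => toLex (w z, if z = x then 0 else 1)
    have hf : ∀ a b, (Tuple.sort f).symm a < (Tuple.sort f).symm b → f a ≤ f b := fun a b hab => by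
      simpa using Tuple.monotone_sort f hab.le
    have hfw : ∀ a b, f a ≤ f b → w a ≤ w b := fun a b hab => by
      rw [Prod.Lex.le_iff] at hab
      exact hab.elim le_of_lt fun h => h.1.le
    have hc := H ((Tuple.sort f).symm, q₀.2) ⟨fun a b hab => hfw a b (hf a b hab), hq₀.2⟩
    rcases lt_trichotomy ((Tuple.sort f).symm x) ((Tuple.sort f).symm y) with hlt | heq | hgt
    · exact hc.1 x y hlt
    · rw [(Tuple.sort f).symm.injective heq]
    · have := hf y x hgt
      rw [Prod.Lex.le_iff] at this
      rcases this with h1 | ⟨-, h1⟩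
      · exact absurd hxy (not_le.2 h1)
      · have hyx : y = x := by
          by_contra hne
          simp [f, hne] at h1
        rw [hyx]
  · rintro ⟨h1, h2⟩ q hq
    exact ⟨fun x y hxy => h1 x y (hq.1 x y hxy), (h'.2 _).1 (h2 ((h.2 _).2 hq.2))⟩

theorem partialSum_sub (d : Fin n → ℝ) (i : Fin n) :
    Fin.partialSum d i.succ - Fin.partialSum d i.castSucc = d i := by
  rw [Fin.partialSum_succ]; ring

theorem Decorated.deco_nonempty [NeZero n] (D : Decorated n) : D.deco.Nonempty := by
  rcases (Nat.succ_le_of_lt D.part.length_pos).eq_or_lt with h | h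
  · rw [D.deco_trivial h.symm]
    exact Finset.univ_nonempty
  · exact (D.deco_nontrivial h).1

theorem exists_rep [NeZero n] (D : Decorated n) : ∃ w, Rep D w := by
  classical
  set S := D.part with hS
  set σ := Tuple.sort S.idx
  have hu : Monotone (S.idx ∘ σ) := Tuple.monotone_sort S.idx
  -- Prescribed gaps: 0 inside a block, 2 at decorated jumps, 1 at the others. With a single block
  -- all gaps vanish and every position is maximal, as `deco_trivial` demands.
  let d : Fin n → ℝ := fun i => if i ∈ S.typeSet then (if i ∈ D.deco then 2 else 1) else 0
  have hd : ∀ i, 0 ≤ d i := fun i => by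
    simp only [d]; split_ifs <;> norm_num
  let v := Fin.partialSum d
  have hv : Monotone v := Fin.monotone_iff_le_succ.2 fun i => by
    have := partialSum_sub d i
    have := hd i
    simp only [v]; linarith
  have hstep : ∀ i : Fin n, (S.idx ∘ σ) i.castSucc = (S.idx ∘ σ) i.succ ↔
      v i.castSucc = v i.succ := fun i => by
    have h1 : v i.castSucc = v i.succ ↔ d i = 0 := by
      rw [← partialSum_sub d i, sub_eq_zero, eq_comm]
    have h2 : d i = 0 ↔ i ∉ S.typeSet := by
      simp only [d]; split_ifs <;> simp_all
    rw [h1, h2, S.mem_typeSet_iff hu, not_lt]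
    exact ⟨fun h => h.ge, fun h => le_antisymm (hu Fin.castSucc_lt_succ.le) h⟩
  have hcomp : (v ∘ σ.symm) ∘ σ = v := by ext; simp
  have hgap : ∀ i, gap (v ∘ σ.symm) i = d i := fun i => by
    rw [gap_of_monotone (σ := σ) (by rwa [hcomp])]
    simpa using partialSum_sub d i
  refine ⟨v ∘ σ.symm, fun x y => ?_, fun i => ?_⟩
  · have h1 := le_of_le_of_step hu hv (fun i => (hstep i).1) (k := σ.symm x) (l := σ.symm y)
    have h2 := le_of_le_of_step hv hu (fun i => (hstep i).2) (k := σ.symm x) (l := σ.symm y)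
    simp only [Function.comp_apply, Equiv.apply_symm_apply] at h1 h2 ⊢
    exact ⟨h1, h2⟩
  · simp only [hgap]
    rcases (Nat.succ_le_of_lt S.length_pos).eq_or_lt with h | h
    · have hB := D.deco_trivial h.symm
      have hT := S.typeSet_eq_empty_iff.2 h.symm
      simp [hB, d, hT]
    · obtain ⟨⟨j, hj⟩, hsub⟩ := D.deco_nontrivial h
      have hdj : d j = 2 := by simp [d, hj, show j ∈ S.typeSet from hsub hj]
      constructor
      · intro hi k
        have hdi : d i = 2 := by simp [d, hi, show i ∈ S.typeSet from hsub hi]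
        rw [hdi]
        simp only [d]; split_ifs <;> norm_num
      · intro hi
        have := hi j
        rw [hdj] at this
        by_contra hne
        simp only [d, if_neg hne] at this
        split_ifs at this <;> linarith

theorem exists_decorated [NeZero n] (w : Fin (n + 1) → ℝ) : ∃ D, Rep D w := by
  classical
  set S := OrderedSetPartition.ofFun w with hS
  have hw : ∀ x y, S.idx x ≤ S.idx y ↔ w x ≤ w y := OrderedSetPartition.ofFun_idx_le_iff w
  have hσ : Monotone (S.idx ∘ Tuple.sort w) := fun a b hab =>
    (hw _ _).2 (Tuple.monotone_sort w hab)
  have htype : ∀ i, i ∈ S.typeSet ↔ 0 < gap w i := fun i => by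
    rw [S.mem_typeSet_iff hσ, ← not_le, hw, not_le, gap, sub_pos]
  let B : Finset (Fin n) := Finset.univ.filter fun i => ∀ j, gap w j ≤ gap w i
  refine ⟨⟨S, B, fun h => ?_, fun h => ⟨?_, fun i hi => ?_⟩⟩, hw, fun i => by simp [B]⟩
  · have h0 : ∀ i, gap w i ≤ 0 := fun i => not_lt.1 fun hi => by
      have := (htype i).2 hi
      simp [S.typeSet_eq_empty_iff.2 h] at this
    simp only [B, Finset.filter_eq_self]
    exact fun i _ j => (h0 j).trans (gap_nonneg w i)
  · obtain ⟨i, hi⟩ := Finite.exists_max (gap w)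
    exact ⟨i, by simpa [B] using hi⟩
  -- With several blocks some gap is positive, hence so is every maximal gap.
  · obtain ⟨j, hj⟩ := Finset.nonempty_iff_ne_empty.2 (mt S.typeSet_eq_empty_iff.1 h.ne')
    exact (htype i).2 (((htype j).1 hj).trans_le ((Finset.mem_filter.1 hi).2 j))

/-- The face poset of the symmetrization is `ℱ_d`. -/
theorem nonempty_faces_orderIso [NeZero n] :
    Nonempty (faces (symmetrization (polytopeP n)) ≃o Decorated n) := by
  choose w hw using exists_rep (n := n)
  let f : Decorated n ↪o faces (symmetrization (polytopeP n)) :=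
    OrderEmbedding.ofMapLEIff (fun D => ⟨face (w D), mem_faces_iff.2 ⟨_, rfl⟩⟩) fun D D' => by
      rw [← compat_imp_iff (hw D) (hw D'), ← face_subset_face_iff]
      rfl
  refine ⟨(RelIso.ofSurjective f ?_ : Decorated n ≃o _).symm⟩
  rintro ⟨F, hF⟩
  obtain ⟨v, rfl⟩ := mem_faces_iff.1 hF
  obtain ⟨D, hD⟩ := exists_decorated v
  -- `v` and the chosen `w D` may differ, but both represent `D` and so give the same face.
  refine ⟨D, Subtype.ext (subset_antisymm ?_ ?_)⟩
  · exact face_subset_face_iff.2 ((compat_imp_iff (hw D) hD).2 le_rfl)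
  · exact face_subset_face_iff.2 ((compat_imp_iff hD (hw D)).2 le_rfl)

end HybridPoset

/-! ### Standard partitions, the normal fan of `P` and `Ω(P)` -/

namespace HybridPoset

variable {n : ℕ}

/-! ### Standard ordered set partitions -/

namespace OrderedSetPartition

theorem IsStandard.monotone_idx {S : OrderedSetPartition n} (h : S.IsStandard) :
    Monotone S.idx := by
  rw [IsStandard, List.isChain_iff_getElem] at h
  have key : ∀ b (hb : b < S.blocks.length) (a) (hab : a < b), ∀ x ∈ S.blocks[a], ∀ y ∈ S.blocks[b],
      x < y := by
    intro b
    induction b with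
    | zero => intro _ a hab; omega
    | succ b ih =>
      intro hb a hab x hx y hy
      rcases (Nat.lt_succ_iff.1 hab).eq_or_lt with rfl | hab'
      · exact h a hb x hx y hy
      -- Nonempty intermediate blocks carry the comparison from adjacent blocks to distant ones.
      · obtain ⟨z, hz⟩ := S.nonempty _ (S.blocks.getElem_mem (Nat.lt_of_succ_lt hb))
        exact (ih _ a hab' x hx z hz).trans (h b hb z hz y hy)
  intro x y hxy
  by_contra hlt
  exact hxy.not_gt (key _ (S.idx x).2 _ (Fin.lt_def.1 (not_le.1 hlt)) y (S.mem_get_iff.2 rfl) x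
    (S.mem_get_iff.2 rfl))

theorem IsStandard.mem_typeSet_iff {S : OrderedSetPartition n} (h : S.IsStandard) {i : Fin n} :
    i ∈ S.typeSet ↔ S.idx i.castSucc < S.idx i.succ :=
  S.mem_typeSet_iff (σ := 1) h.monotone_idx

theorem IsStandard.idx_eq_of_notMem {S : OrderedSetPartition n} (h : S.IsStandard) {i : Fin n}
    (hi : i ∉ S.typeSet) : S.idx i.castSucc = S.idx i.succ :=
  le_antisymm (h.monotone_idx Fin.castSucc_lt_succ.le) (not_lt.1 (mt h.mem_typeSet_iff.2 hi))

/-- Both block indices are monotone, so merging consecutive blocks just deletes jumps. -/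
theorem IsStandard.le_iff {S S' : OrderedSetPartition n} (h : S.IsStandard) (h' : S'.IsStandard) :
    S ≤ S' ↔ S'.typeSet ⊆ S.typeSet := by
  change (∀ x y, _ → _) ↔ _
  simp only [weaklyBefore_iff]
  constructor
  · intro H i hi
    rw [h'.mem_typeSet_iff] at hi
    exact h.mem_typeSet_iff.2 (not_le.1 fun hle => hi.not_ge (H _ _ hle))
  · intro H x y hxy
    refine le_of_le_of_step h.monotone_idx h'.monotone_idx (fun i hi => ?_) hxy
    exact h'.idx_eq_of_notMem fun hi' => (h.mem_typeSet_iff.1 (H hi')).ne hi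

theorem isStandard_ofFun {w : Fin (n + 1) → ℝ} (hw : Monotone w) : (ofFun w).IsStandard := by
  rw [IsStandard, List.isChain_iff_getElem]
  intro i hi x hx y hy
  have hx' : (ofFun w).idx x = ⟨i, Nat.lt_of_succ_lt hi⟩ := (ofFun w).mem_get_iff.1 hx
  have hy' : (ofFun w).idx y = ⟨i + 1, hi⟩ := (ofFun w).mem_get_iff.1 hy
  by_contra hxy
  have := (ofFun_idx_le_iff w y x).2 (hw (not_lt.1 hxy))
  simp [hx', hy'] at this

theorem exists_standard (C : Finset (Fin n)) :
    ∃ S : OrderedSetPartition n, S.IsStandard ∧ S.typeSet = C := by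
  classical
  let d : Fin n → ℝ := fun i => if i ∈ C then 1 else 0
  have hv : Monotone (Fin.partialSum d) := Fin.monotone_iff_le_succ.2 fun i => by
    have h := partialSum_sub d i
    have : 0 ≤ d i := by simp only [d]; split_ifs <;> norm_num
    linarith
  refine ⟨ofFun (Fin.partialSum d), isStandard_ofFun hv, ?_⟩
  ext i
  rw [(isStandard_ofFun hv).mem_typeSet_iff, ← not_le, ofFun_idx_le_iff, not_le, ← sub_pos,
    partialSum_sub]
  simp only [d]
  split_ifs with h <;> simp [h]

end OrderedSetPartition

/-! ### The coordinates `δ` on `W` -/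

theorem delta_mk (v : Fin (n + 1) → ℝ) (i : Fin n) :
    delta i (Submodule.Quotient.mk v : W n) = v i.succ - v i.castSucc := rfl

theorem diff_mk (v : Fin (n + 1) → ℝ) (i j : Fin (n + 1)) :
    diff i j (Submodule.Quotient.mk v : W n) = v j - v i := rfl

/-- The vector with given first differences. -/
noncomputable def ofDelta (d : Fin n → ℝ) : W n := Submodule.Quotient.mk (Fin.partialSum d)

@[simp]
theorem delta_ofDelta (d : Fin n → ℝ) (i : Fin n) : delta i (ofDelta d) = d i :=
  partialSum_sub d i

theorem ext_delta {w w' : W n} (h : ∀ i, delta i w = delta i w') : w = w' := by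
  obtain ⟨v, rfl⟩ := Submodule.Quotient.mk_surjective _ w
  obtain ⟨v', rfl⟩ := Submodule.Quotient.mk_surjective _ w'
  rw [Submodule.Quotient.eq, Submodule.mem_span_singleton]
  refine ⟨v 0 - v' 0, funext fun k => ?_⟩
  induction k using Fin.induction with
  | zero => simp
  | succ k ih =>
    have := h k
    simp only [delta_mk] at this
    simp only [Pi.smul_apply, Pi.one_apply, smul_eq_mul, mul_one, Pi.sub_apply] at ih ⊢
    linarith

theorem eq_sum_delta (w : W n) : w = ∑ i, delta i w • ofDelta (Pi.single i 1) := by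
  refine ext_delta fun j => ?_
  simp [map_sum, Pi.single_apply]

theorem continuous_delta (i : Fin n) : Continuous (delta i : W n → ℝ) := by
  refine (Submodule.isQuotientMap_mkQ _).continuous_iff.2 ?_
  change Continuous fun v : Fin (n + 1) → ℝ => v i.succ - v i.castSucc
  fun_prop

/-- `δ_i` as a continuous functional. -/
noncomputable def deltaCLM (i : Fin n) : StrongDual ℝ (W n) := ⟨delta i, continuous_delta i⟩

theorem deltaCLM_apply (i : Fin n) (w : W n) : deltaCLM i w = delta i w := rfl

theorem mem_Phi_iff {w : W n} : w ∈ Phi n ↔ ∀ i, 0 ≤ delta i w := by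
  obtain ⟨v, rfl⟩ := Submodule.Quotient.mk_surjective _ w
  simp only [Phi, Set.mem_ofPred_eq, diff_mk, delta_mk, sub_nonneg]
  exact Fin.monotone_iff_le_succ

/-- The face of `Φ` on which only the differences with index in `C` may be nonzero. -/
def phiCone (C : Finset (Fin n)) : Set (W n) :=
  {w | (∀ i, 0 ≤ delta i w) ∧ ∀ i ∉ C, delta i w = 0}

/-- Membership in `σ_S` says that `w` is weakly increasing in the block index; for standard `S` this
means increasing with jumps only at the type. -/
theorem sigmaCone_eq_phiCone {S : OrderedSetPartition n} (h : S.IsStandard) :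
    sigmaCone S = phiCone S.typeSet := by
  have hs : ∀ w : W n, w ∈ sigmaCone S ↔ ∀ x y, S.idx x ≤ S.idx y → 0 ≤ diff x y w := by
    intro w
    constructor
    · rintro ⟨h1, h2⟩ x y hxy
      rcases hxy.eq_or_lt with heq | hlt
      · exact (h1 _ (S.blocks.get_mem (S.idx y)) x (S.mem_get_iff.2 heq) y
          (S.mem_get_iff.2 rfl)).ge
      · exact h2 _ _ hlt x (S.mem_get_iff.2 rfl) y (S.mem_get_iff.2 rfl)
    · intro H
      refine ⟨fun A hA x hx y hy => ?_, fun a b hab x hx y hy => ?_⟩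
      · obtain ⟨a, rfl⟩ := List.get_of_mem hA
        rw [S.mem_get_iff] at hx hy
        have h1 := H x y (by rw [hx, hy])
        have h2 := H y x (by rw [hx, hy])
        obtain ⟨v, rfl⟩ := Submodule.Quotient.mk_surjective _ w
        rw [diff_mk] at *
        linarith
      · rw [S.mem_get_iff] at hx hy
        exact H x y (by rw [hx, hy]; exact hab.le)
  ext w
  rw [hs]
  obtain ⟨v, rfl⟩ := Submodule.Quotient.mk_surjective _ w
  simp only [phiCone, Set.mem_ofPred_eq, diff_mk, delta_mk, sub_nonneg, sub_eq_zero]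
  constructor
  · intro H
    exact ⟨fun i => H _ _ (h.monotone_idx Fin.castSucc_lt_succ.le), fun i hi =>
      le_antisymm (H _ _ (h.idx_eq_of_notMem hi).ge) (H _ _ (h.idx_eq_of_notMem hi).le)⟩
  · rintro ⟨h1, h2⟩ x y hxy
    refine le_of_le_of_step h.monotone_idx (Fin.monotone_iff_le_succ.2 h1) (fun i hi => ?_) hxy
    exact (h2 i fun hi' => (h.mem_typeSet_iff.1 hi').ne hi).symm

/-- On an orthant a functional attains a maximum only if its coefficients are nonpositive; its
maximizers then vanish wherever the coefficient is negative. -/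
theorem mem_faces_Phi_iff {F : Set (W n)} : F ∈ faces (Phi n) ↔ ∃ C, F = phiCone C := by
  classical
  have key : ∀ l : StrongDual ℝ (W n), (∀ i, l (ofDelta (Pi.single i 1)) ≤ 0) →
      {x | x ∈ Phi n ∧ ∀ y ∈ Phi n, l y ≤ l x} =
        phiCone (Finset.univ.filter fun i => l (ofDelta (Pi.single i 1)) = 0) := by
    intro l hl
    have hsum : ∀ w, l w = ∑ i, delta i w * l (ofDelta (Pi.single i 1)) := fun w => by
      conv_lhs => rw [eq_sum_delta w, map_sum]
      simp
    have hnp : ∀ w ∈ Phi n, ∀ i, delta i w * l (ofDelta (Pi.single i 1)) ≤ 0 := fun w hw i =>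
      mul_nonpos_of_nonneg_of_nonpos (mem_Phi_iff.1 hw i) (hl i)
    ext w
    constructor
    · rintro ⟨hw, hmax⟩
      refine ⟨mem_Phi_iff.1 hw, fun i hi => ?_⟩
      have h0 : 0 ≤ l w := by
        simpa using hmax 0 (mem_Phi_iff.2 fun i => by simp)
      rw [hsum] at h0
      have h1 := (Finset.sum_eq_zero_iff_of_nonpos fun i _ => hnp w hw i).1
        (le_antisymm (Finset.sum_nonpos fun i _ => hnp w hw i) h0) i (Finset.mem_univ i)
      exact (mul_eq_zero.1 h1).resolve_right (by simpa using hi)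
    · rintro ⟨h1, h2⟩
      refine ⟨mem_Phi_iff.2 h1, fun y hy => ?_⟩
      have h0 : l w = 0 := by
        rw [hsum]
        refine Finset.sum_eq_zero fun i _ => ?_
        by_cases hi : l (ofDelta (Pi.single i 1)) = 0
        · rw [hi, mul_zero]
        · rw [h2 i (by simpa using hi), zero_mul]
      rw [h0, hsum]
      exact Finset.sum_nonpos fun i _ => hnp y hy i
  constructor
  · rintro ⟨hne, hF⟩
    obtain ⟨l, rfl⟩ := hF hne
    refine ⟨_, key l fun i => ?_⟩
    obtain ⟨x, hx, hmax⟩ := hne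
    -- Moving a maximizer along a generating ray stays in `Φ`, so no coefficient is positive.
    have := hmax (x + ofDelta (Pi.single i 1)) (mem_Phi_iff.2 fun j => by
      have h1 := mem_Phi_iff.1 hx j
      have h2 : (0 : ℝ) ≤ (Pi.single i 1 : Fin n → ℝ) j := by
        rw [Pi.single_apply]; split_ifs <;> norm_num
      rw [map_add, delta_ofDelta]
      positivity)
    rw [map_add] at this
    linarith
  · rintro ⟨C, rfl⟩
    refine ⟨⟨0, by simp [phiCone]⟩, fun _ => ?_⟩
    let l : StrongDual ℝ (W n) := ∑ i, (if i ∈ C then (0 : ℝ) else -1) • deltaCLM i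
    have hl : ∀ i, l (ofDelta (Pi.single i 1)) = if i ∈ C then 0 else -1 := fun i => by
      simp [-ite_smul, l, deltaCLM_apply, Pi.single_apply]
    refine ⟨l, ?_⟩
    rw [key l fun i => by rw [hl]; split_ifs <;> norm_num]
    congr 1
    ext i
    simp [hl]

/-! ### The normal fan of `P` -/

theorem pairing_mk (u v : Fin (n + 1) → ℝ) :
    pairing u (Submodule.Quotient.mk v : W n) = ∑ j, (u j - (∑ k, u k) / (n + 1)) * v j := by
  change (∑ j, (u j - (∑ k, u k) / (n + 1)) •
    (LinearMap.proj j : (Fin (n + 1) → ℝ) →ₗ[ℝ] ℝ)) v = _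
  simp

/-- The pairing with a fixed `w` as a linear functional on `ℝ^d`. -/
noncomputable def pairingLeft (w : W n) : (Fin (n + 1) → ℝ) →ₗ[ℝ] ℝ where
  toFun u := pairing u w
  map_add' u u' := by
    obtain ⟨v, rfl⟩ := Submodule.Quotient.mk_surjective _ w
    simp only [pairing_mk, ← Finset.sum_add_distrib, Pi.add_apply]
    refine Finset.sum_congr rfl fun j _ => ?_
    rw [Finset.sum_add_distrib]
    ring
  map_smul' c u := by
    obtain ⟨v, rfl⟩ := Submodule.Quotient.mk_surjective _ w
    simp only [pairing_mk, Finset.mul_sum, Pi.smul_apply, smul_eq_mul, RingHom.id_apply]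
    refine Finset.sum_congr rfl fun j _ => ?_
    rw [← Finset.mul_sum]
    ring

theorem sum_rootVec (i : Fin n) : ∑ k, rootVec i k = 0 := by
  simpa using sum_mul_rootVec 1 i

/-- The coordinates of `a_i` sum to 0, so the centring in `pairing` has no effect. -/
theorem pairingLeft_rootVec (w : W n) (i : Fin n) : pairingLeft w (rootVec i) = delta i w := by
  obtain ⟨v, rfl⟩ := Submodule.Quotient.mk_surjective _ w
  change pairing (rootVec i) (Submodule.Quotient.mk v : W n) = _
  rw [pairing_mk, sum_rootVec, delta_mk, ← sum_mul_rootVec]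
  simp [mul_comm]

theorem pairingLeft_vtx (w : W n) (i : Fin n) :
    pairingLeft w (vtx i) = pairingLeft w (gamma0 n) + delta i w := by
  rw [vtx, map_add, pairingLeft_rootVec]

theorem mem_nuCone_iff {B : Finset (Fin n)} {w : W n} :
    w ∈ nuCone B ↔ ∀ i ∈ B, ∀ j, delta j w ≤ delta i w := by
  constructor
  · rintro ⟨h1, h2⟩ i hi j
    by_cases hj : j ∈ B
    · exact (h1 j hj i hi).le
    · exact h2 j hj i hi
  · exact fun h => ⟨fun i hi j hj => le_antisymm (h j hj i) (h i hi j), fun i _ j hj => h j hj i⟩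

theorem ncone_convexHull_vtx {B : Finset (Fin n)} (hB : B.Nonempty) :
    ncone (convexHull ℝ (vtx '' (B : Set (Fin n)))) (polytopeP n) = nuCone B := by
  ext w
  rw [mem_nuCone_iff, polytopeP_eq]
  change (∀ y ∈ _, ∀ y' ∈ _, pairingLeft w y' ≤ pairingLeft w y) ↔ _
  constructor
  · intro h i hi j
    have := h (vtx i) (subset_convexHull ℝ _ ⟨i, hi, rfl⟩) (vtx j) (subset_convexHull ℝ _ ⟨j, rfl⟩)
    simpa [pairingLeft_vtx] using this
  · intro h y hy y' hy'
    obtain ⟨i, hi⟩ := hB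
    refine le_trans (b := pairingLeft w (vtx i)) ?_ ?_
    · refine convexHull_min (t := {y' | pairingLeft w y' ≤ pairingLeft w (vtx i)}) ?_
        (convex_halfSpace_le (pairingLeft w).isLinear _) hy'
      rintro _ ⟨j, rfl⟩
      simpa [pairingLeft_vtx] using h i hi j
    · refine convexHull_min (t := {y | pairingLeft w (vtx i) ≤ pairingLeft w y}) ?_
        (convex_halfSpace_ge (pairingLeft w).isLinear _) hy
      rintro _ ⟨j, hj, rfl⟩
      simpa [pairingLeft_vtx] using h j hj i

theorem mem_normalFan_iff [NeZero n] {σ : Set (W n)} :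
    σ ∈ normalFan (polytopeP n) ↔ ∃ B : Finset (Fin n), B.Nonempty ∧ σ = nuCone B := by
  classical
  have hfaces : ∀ F, F ∈ faces (polytopeP n) ↔
      ∃ B : Finset (Fin n), B.Nonempty ∧ F = convexHull ℝ (vtx '' (B : Set (Fin n))) := by
    intro F
    rw [polytopeP_eq, faces_convexHull_range]
    constructor
    · rintro ⟨l, rfl⟩
      refine ⟨Finset.univ.filter fun i => ∀ j, l (vtx j) ≤ l (vtx i), ?_, by simp⟩
      obtain ⟨i, hi⟩ := Finite.exists_max fun i => l (vtx i)
      exact ⟨i, by simpa using hi⟩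
    · rintro ⟨B, ⟨b, hb⟩, rfl⟩
      -- The `δ_i` can be prescribed freely; with the indicator of `B`, the maximal vertices are
      -- exactly those of `B`.
      refine ⟨(pairingLeft (ofDelta fun i => if i ∈ B then 1 else 0)).toContinuousLinearMap, ?_⟩
      congr 2
      ext i
      simp only [LinearMap.coe_toContinuousLinearMap', pairingLeft_vtx, delta_ofDelta,
        add_le_add_iff_left, Set.mem_ofPred_eq, Finset.mem_coe]
      constructor
      · intro hi j
        rw [if_pos hi]
        split_ifs <;> norm_num
      · intro h
        have := h b
        by_contra hi
        rw [if_pos hb, if_neg hi] at this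
        norm_num at this
  constructor
  · rintro ⟨F, hF, rfl⟩
    obtain ⟨B, hB, rfl⟩ := (hfaces F).1 hF
    exact ⟨B, hB, ncone_convexHull_vtx hB⟩
  · rintro ⟨B, hB, rfl⟩
    exact ⟨_, (hfaces _).2 ⟨B, hB, rfl⟩, (ncone_convexHull_vtx hB).symm⟩

theorem nuCone_subset_iff {B B' : Finset (Fin n)} (hB : B.Nonempty) :
    nuCone B ⊆ nuCone B' ↔ B' ⊆ B := by
  classical
  constructor
  · intro h i hi
    obtain ⟨b, hb⟩ := hB
    have hmem : ofDelta (fun i => if i ∈ B then (1 : ℝ) else 0) ∈ nuCone B := by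
      rw [mem_nuCone_iff]
      intro i hi j
      rw [delta_ofDelta, delta_ofDelta, if_pos hi]
      split_ifs <;> norm_num
    have := mem_nuCone_iff.1 (h hmem) i hi b
    by_contra hne
    rw [delta_ofDelta, delta_ofDelta, if_pos hb, if_neg hne] at this
    norm_num at this
  · intro h w hw
    rw [mem_nuCone_iff] at hw ⊢
    exact fun i hi => hw i (h hi)

theorem phiCone_subset_iff {C C' : Finset (Fin n)} : phiCone C ⊆ phiCone C' ↔ C ⊆ C' := by
  classical
  constructor
  · intro h i hi
    have hmem : ofDelta (fun i => if i ∈ C then (1 : ℝ) else 0) ∈ phiCone C := by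
      refine ⟨fun i => ?_, fun i hi => by rw [delta_ofDelta, if_neg hi]⟩
      rw [delta_ofDelta]
      split_ifs <;> norm_num
    by_contra hne
    have := (h hmem).2 i hne
    rw [delta_ofDelta, if_pos hi] at this
    norm_num at this
  · exact fun h w hw => ⟨hw.1, fun i hi => hw.2 i fun hi' => hi (h hi')⟩

/-! ### Relative interiors -/

/-- The relative interior of a polyhedral cone that contains a point at which all defining
inequalities are strict. -/
theorem intrinsicInterior_eq {E : Type*} [AddCommGroup E] [Module ℝ E] [TopologicalSpace E]
    [IsTopologicalAddGroup E] [ContinuousSMul ℝ E] {ι κ : Type*} [Finite κ] (f : ι → E →ₗ[ℝ] ℝ)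
    (g : κ → StrongDual ℝ E) (hne : ∃ w₀, (∀ i, f i w₀ = 0) ∧ ∀ k, 0 < g k w₀) :
    intrinsicInterior ℝ {w | (∀ i, f i w = 0) ∧ ∀ k, 0 ≤ g k w} =
      {w | (∀ i, f i w = 0) ∧ ∀ k, 0 < g k w} := by
  set K := {w | (∀ i, f i w = 0) ∧ ∀ k, 0 ≤ g k w} with hK
  obtain ⟨w₀, hw₀, hg₀⟩ := hne
  have hspan : ∀ w ∈ affineSpan ℝ K, ∀ i, f i w = 0 := by
    have : affineSpan ℝ K ≤ (⨅ i, LinearMap.ker (f i)).toAffineSubspace := by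
      rw [affineSpan_le]
      intro w hw
      simpa using hw.1
    intro w hw i
    have := this hw
    simp only [Submodule.mem_toAffineSubspace, Submodule.mem_iInf, LinearMap.mem_ker] at this
    exact this i
  have hw₀K : w₀ ∈ K := ⟨hw₀, fun k => (hg₀ k).le⟩
  ext w
  rw [mem_intrinsicInterior]
  constructor
  · rintro ⟨⟨x, hx⟩, hint, rfl⟩
    have hxK : x ∈ K := interior_subset (s := ((↑) ⁻¹' K : Set (affineSpan ℝ K))) hint
    refine ⟨hxK.1, fun k => (hxK.2 k).lt_of_ne' fun h0 => ?_⟩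
    -- If `g k x = 0`, continuing the line from `w₀` slightly past `x` (negative `t`) stays in `K`
    -- by interiority, yet makes `g k` negative.
    let c : ℝ → affineSpan ℝ K := fun t => ⟨AffineMap.lineMap x w₀ t,
      AffineMap.lineMap_mem _ hx (subset_affineSpan ℝ _ hw₀K)⟩
    have hc : Continuous c := AffineMap.lineMap_continuous.subtype_mk _
    have hc0 : c 0 = ⟨x, hx⟩ := Subtype.ext (by simp [c])
    have hnhds : ∀ᶠ t in nhds (0 : ℝ), c t ∈ interior ((↑) ⁻¹' K : Set (affineSpan ℝ K)) :=
      hc.continuousAt.eventually (isOpen_interior.mem_nhds (by rw [hc0]; exact hint))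
    obtain ⟨ε, hε, hball⟩ := Metric.eventually_nhds_iff.1 hnhds
    have hmem : c (-(ε / 2)) ∈ interior ((↑) ⁻¹' K : Set (affineSpan ℝ K)) :=
      hball (by rw [Real.dist_eq, sub_zero, abs_neg, abs_of_pos (by linarith)]; linarith)
    have hge := (interior_subset (s := ((↑) ⁻¹' K : Set (affineSpan ℝ K))) hmem).2 k
    simp only [c, AffineMap.lineMap_apply_module, map_add, map_smul, smul_eq_mul, h0] at hge
    have := mul_pos hε (hg₀ k)
    linarith
  · rintro ⟨h1, h2⟩
    have hwK : w ∈ K := ⟨h1, fun k => (h2 k).le⟩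
    refine ⟨⟨w, subset_affineSpan ℝ _ hwK⟩, ?_, rfl⟩
    -- Finitely many strict inequalities are an open condition, and the equations hold on the whole
    -- affine span.
    refine mem_interior.2 ⟨⋂ k, {x : affineSpan ℝ K | 0 < g k x}, ?_, ?_, ?_⟩
    · intro x hx
      simp only [Set.mem_iInter, Set.mem_ofPred_eq] at hx
      exact ⟨hspan x x.2, fun k => (hx k).le⟩
    · exact isOpen_iInter_of_finite fun k =>
        isOpen_lt continuous_const ((g k).continuous.comp continuous_subtype_val)
    · simpa using h2

theorem intrinsicInterior_phiCone (C : Finset (Fin n)) :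
    intrinsicInterior ℝ (phiCone C) =
      {w | (∀ i ∈ C, 0 < delta i w) ∧ ∀ i ∉ C, delta i w = 0} := by
  classical
  have h := intrinsicInterior_eq (fun i : {i // i ∉ C} => delta i.1)
    (fun i : {i // i ∈ C} => deltaCLM i.1)
    ⟨ofDelta fun i => if i ∈ C then 1 else 0, fun i => by simp [i.2],
      fun i => by simp [deltaCLM_apply, i.2]⟩
  simp only [deltaCLM_apply, Subtype.forall] at h
  have hcone : phiCone C = {w | (∀ i ∉ C, delta i w = 0) ∧ ∀ i ∈ C, 0 ≤ delta i w} := by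
    ext w
    refine ⟨fun hw => ⟨hw.2, fun i _ => hw.1 i⟩, fun hw => ⟨fun i => ?_, hw.1⟩⟩
    by_cases hi : i ∈ C
    · exact hw.2 i hi
    · exact (hw.1 i hi).ge
  rw [hcone, h]
  ext w
  exact and_comm

theorem intrinsicInterior_nuCone {B : Finset (Fin n)} :
    intrinsicInterior ℝ (nuCone B) =
      {w | (∀ i ∈ B, ∀ j ∈ B, delta i w = delta j w) ∧
        ∀ i ∉ B, ∀ j ∈ B, delta i w < delta j w} := by
  classical
  have h := intrinsicInterior_eq
    (fun p : {i // i ∈ B} × {i // i ∈ B} => delta p.1.1 - delta p.2.1)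
    (fun p : {i // i ∉ B} × {i // i ∈ B} => deltaCLM p.2.1 - deltaCLM p.1.1)
    ⟨ofDelta fun i => if i ∈ B then 1 else 0, fun p => by simp [p.1.2, p.2.2],
      fun p => by simp [deltaCLM_apply, p.1.2, p.2.2]⟩
  simp only [LinearMap.sub_apply, _root_.sub_apply, deltaCLM_apply, Prod.forall,
    Subtype.forall, sub_nonneg, sub_pos, sub_eq_zero] at h
  have hL : nuCone B = {w : W n | (∀ i ∈ B, ∀ j ∈ B, delta i w = delta j w) ∧
      ∀ i ∉ B, ∀ j ∈ B, delta i w ≤ delta j w} := rfl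
  rw [hL]
  convert h using 3

/-- The relative interiors of `ν_B` and of a face of `Φ` meet exactly for the decorations allowed in
a decorated ordered set partition. -/
theorem interiors_meet_iff {B C : Finset (Fin n)} (hB : B.Nonempty) :
    (intrinsicInterior ℝ (nuCone B) ∩ intrinsicInterior ℝ (phiCone C)).Nonempty ↔
      (C = ∅ → B = Finset.univ) ∧ (C ≠ ∅ → B ⊆ C) := by
  classical
  rw [intrinsicInterior_nuCone, intrinsicInterior_phiCone]
  constructor
  · rintro ⟨w, ⟨h1, h2⟩, h3, h4⟩
    refine ⟨?_, fun hC i hi => ?_⟩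
    · rintro rfl
      obtain ⟨b, hb⟩ := hB
      refine Finset.eq_univ_iff_forall.2 fun i => ?_
      by_contra hi
      have := h2 i hi b hb
      rw [h4 i (by simp), h4 b (by simp)] at this
      exact lt_irrefl _ this
    -- Otherwise `δ_i = 0` would be the maximal difference, although `δ_c > 0` for any `c ∈ C`.
    · by_contra hiC
      obtain ⟨c, hc⟩ := Finset.nonempty_iff_ne_empty.2 hC
      have hc0 := h3 c hc
      rw [← h4 i hiC] at hc0
      by_cases hcB : c ∈ B
      · exact hc0.ne (h1 i hi c hcB)
      · exact hc0.not_gt (h2 c hcB i hi)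
  · rintro ⟨h1, h2⟩
    rcases eq_or_ne C ∅ with rfl | hC
    · obtain rfl := h1 rfl
      exact ⟨0, by simp⟩
    · have hBC := h2 hC
      refine ⟨ofDelta fun i => if i ∈ B then 2 else if i ∈ C then 1 else 0,
        ⟨fun i hi j hj => by simp [hi, hj], fun i hi j hj => ?_⟩, fun i hi => ?_, fun i hi => ?_⟩
      · rw [delta_ofDelta, delta_ofDelta, if_neg hi, if_pos hj]
        split_ifs <;> norm_num
      · rw [delta_ofDelta, if_pos hi]
        split_ifs <;> norm_num
      · rw [delta_ofDelta, if_neg hi, if_neg fun h => hi (hBC h)]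

/-! ### The isomorphism from `𝒵_d` to `Ω(P)` -/

theorem Z.isStandard (D : Z n) : D.part.IsStandard := D.2

theorem Z.deco_nonempty [NeZero n] (D : Z n) : D.deco.Nonempty :=
  Decorated.deco_nonempty (OrderDual.ofDual D.1)

theorem lam_mem_faces (D : Z n) : lam D ∈ faces (Phi n) :=
  mem_faces_Phi_iff.2 ⟨_, sigmaCone_eq_phiCone D.isStandard⟩

theorem Z.mem_Omega [NeZero n] (D : Z n) :
    (nuCone D.deco, sigmaCone D.part) ∈ Omega (polytopeP n) := by
  refine ⟨mem_normalFan_iff.2 ⟨_, D.deco_nonempty, rfl⟩, lam_mem_faces D, ?_⟩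
  dsimp only
  rw [sigmaCone_eq_phiCone D.isStandard, interiors_meet_iff D.deco_nonempty, ne_eq,
    OrderedSetPartition.typeSet_eq_empty_iff]
  refine ⟨(OrderDual.ofDual D.1).deco_trivial, fun h => ?_⟩
  exact ((OrderDual.ofDual D.1).deco_nontrivial
    (lt_of_le_of_ne D.part.length_pos (Ne.symm h))).2

/-- The order embedding `(S, B) ↦ (ν_B, σ_S)`. -/
noncomputable def omegaEmbedding [NeZero n] : Z n ↪o Omega (polytopeP n) :=
  OrderEmbedding.ofMapLEIff (fun D => ⟨(nuCone D.deco, sigmaCone D.part), D.mem_Omega⟩)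
    fun D D' => by
      -- Both cones reverse the order: `ν_B` shrinks as `B` grows, and `σ_S` shrinks as blocks
      -- merge. This is why `𝒵_d` sits in the dual of `ℱ_d`.
      change nuCone D.deco ⊆ nuCone D'.deco ∧ sigmaCone D.part ⊆ sigmaCone D'.part ↔
        D'.part ≤ D.part ∧ D'.deco ⊆ D.deco
      rw [nuCone_subset_iff D.deco_nonempty, sigmaCone_eq_phiCone D.isStandard,
        sigmaCone_eq_phiCone D'.isStandard, phiCone_subset_iff,
        D'.isStandard.le_iff D.isStandard, and_comm]

theorem omegaEmbedding_surjective [NeZero n] : Function.Surjective (omegaEmbedding (n := n)) := by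
  rintro ⟨⟨σ, φ⟩, hσ, hφ, hmeet⟩
  obtain ⟨B, hB, rfl⟩ := mem_normalFan_iff.1 hσ
  obtain ⟨C, rfl⟩ := mem_faces_Phi_iff.1 hφ
  obtain ⟨h1, h2⟩ := (interiors_meet_iff hB).1 hmeet
  obtain ⟨S, hS, rfl⟩ := OrderedSetPartition.exists_standard C
  rw [ne_eq, OrderedSetPartition.typeSet_eq_empty_iff] at h2
  rw [OrderedSetPartition.typeSet_eq_empty_iff] at h1
  refine ⟨⟨OrderDual.toDual ⟨S, B, h1, fun h => ⟨hB, h2 h.ne'⟩⟩, hS⟩, Subtype.ext ?_⟩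
  exact Prod.ext rfl (sigmaCone_eq_phiCone hS)

/-- The isomorphism `(S, B) ↦ (ν_B, σ_S)` from `𝒵_d` to `Ω(P)`. -/
noncomputable def omegaIso [NeZero n] : Z n ≃o Omega (polytopeP n) :=
  RelIso.ofSurjective omegaEmbedding omegaEmbedding_surjective

/-- `F^lam` is isomorphic to `F`. -/
def LambdaPoset.orderIso {F C : Type*} [PartialOrder F] (l : F → C) : LambdaPoset l ≃o F where
  toFun p := p.1.1
  invFun x := ⟨(x, l x), rfl⟩
  left_inv p := Subtype.ext (Prod.ext rfl p.2.symm)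
  right_inv _ := rfl
  map_rel_iff' := Iff.rfl

end HybridPoset

theorem mainTheorem4 (n : ℕ) (hn : 1 ≤ n) :
    -- `(S, B) ↦ (ν_B, σ_S)` is a poset isomorphism from `𝒵_d` to `Ω(P)`, where `d = n + 1`
    (∃ f : HybridPoset.Z n ≃o HybridPoset.Omega (HybridPoset.polytopeP n),
      ∀ D : HybridPoset.Z n,
        (f D).1 = (HybridPoset.nuCone D.deco, HybridPoset.sigmaCone D.part)) ∧
    -- `λ` takes values in `Σ(Φ)`, and `((S, B), σ_S) ↦ (ν_B, σ_S)` is a `Σ(Φ)`-poset isomorphism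
    -- (a poset isomorphism preserving second entries) from `𝒵_d^λ` to `Ω(P)`
    (∀ D : HybridPoset.Z n, HybridPoset.lam D ∈ HybridPoset.faces (HybridPoset.Phi n)) ∧
    (∃ g : HybridPoset.LambdaPoset (HybridPoset.lam (n := n)) ≃o
        HybridPoset.Omega (HybridPoset.polytopeP n),
      (∀ p, (g p).1.2 = p.1.2) ∧
      ∀ p, (g p).1 = (HybridPoset.nuCone p.1.1.deco, HybridPoset.sigmaCone p.1.1.part)) ∧
    -- the symmetrization of `P` is `Conv {π(γ₀) + π(a_i)}`
    HybridPoset.symmetrization (HybridPoset.polytopeP n) =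
      convexHull ℝ {y | ∃ (π : Equiv.Perm (Fin (n + 1))) (i : Fin n),
        y = HybridPoset.permAct π (HybridPoset.gamma0 n) +
          HybridPoset.permAct π (HybridPoset.rootVec i)} ∧
    -- its face poset is isomorphic to `ℱ_d`
    Nonempty (HybridPoset.faces (HybridPoset.symmetrization (HybridPoset.polytopeP n)) ≃o
      HybridPoset.Decorated n) := by

  have : NeZero n := ⟨by omega⟩
  refine ⟨⟨HybridPoset.omegaIso, fun _ => rfl⟩, HybridPoset.lam_mem_faces,
    ⟨(HybridPoset.LambdaPoset.orderIso _).trans HybridPoset.omegaIso, fun p => p.2.symm,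
      fun _ => rfl⟩, ?_, HybridPoset.nonempty_faces_orderIso⟩
  rw [HybridPoset.symmetrization_polytopeP, HybridPoset.symmetrization_generators]
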